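/- Let $K$ be an algebraically closed field of characteristic $0$ and let $H=(u(x,y),v(x,y,z),h(x,y))$ be a polynomial map with $u,h\in K[x,y]$ and $v\in K[x,y,z]$. Assume that $H(0)=0$, that $u,v,h$ are linearly independent over $K$, that the Jacobian matrix $JH$ (the matrix of partial derivatives of the components of $H$ with respect to $x,y,z$) is nilpotent, and that $\gcd(\deg_y u,\deg_y h)\le 3$, where $\deg_y f$ denotes the highest degree of $y$ in $f$. Then there exist $v_1,c_0,a\in K\setminus\{0\}$, $l_1,l_2,\tilde l_2\in K$ and a polynomial $g(t)\in K[t]$ with $g(0)=0$ and $\deg_t g\ge 1$ such that, with $b(x)=v_1c_0a x^2+l_1x+\tilde l_2$, $$u=g(ay+b(x)),\qquad v=v_1z-a^{-1}b'(x)\,g(ay+b(x))-v_1l_2x,\qquad h=c_0u^2+l_2u.$$ -/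

import Mathlib

/-- The Jacobian matrix `JH = (∂H_i/∂x_j)` of a polynomial map `H = (H_1, …, H_n)`. -/
noncomputable def polyJacobian {n : ℕ} {K : Type*} [CommRing K]
    (H : Fin n → MvPolynomial (Fin n) K) : Matrix (Fin n) (Fin n) (MvPolynomial (Fin n) K) :=
  Matrix.of fun i j => MvPolynomial.pderiv j (H i)

/-! Write subscripts for partial derivatives. Nilpotency gives `v_y = -u_x`, `-u_y v_x - u_x² = v_z
h_y` and `v_z (u_x h_y - u_y h_x) = 0`. Differentiating the second identity in `z` and using linear
independence forces `v_z` to be a constant `v₁`.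

Put `w = -v` and `k = v₁ h`. On the fraction field, `E = ∂x + m ∂y` with `m = -u_x / u_y` is tangent
to the level curves of `u`, and commutes with `d/du = u_y⁻¹ ∂y`. Since `E k = 0`, `E w = dk/du` and
`m = -dw/du`, we get `E m = -l` with `l = d²k/du²` and `E l = 0`. Thus `E x = 1` and `E³ y = 0`, so
`u` is constant along `(x + t, y + m t - l t² / 2)`.

The top weighted form of `u` makes the leading coefficient of such a curve algebraic over `K`, hence
an element of `K`. This gives `l ∈ K`; after a shear straightens the parabolas, the same argument
gives `m + l x ∈ K`. So `u_x = b'(x) u_y` with `b` quadratic, and `u` is a polynomial in `y + b(x)`.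
Integrating the remaining identities gives `h` and `v`; independence gives `v₁, l ≠ 0`. -/

/-! ### Derivations on fraction fields -/

/-- A derivation of a domain extends to its field of fractions. -/
theorem Derivation.exists_extension_fractionRing {K R : Type*} [CommRing K] [CommRing R]
    [IsDomain R] [Algebra K R] (d : Derivation K R R) :
    ∃ D : Derivation K (FractionRing R) (FractionRing R),
      ∀ a, D (algebraMap R (FractionRing R) a) = algebraMap R (FractionRing R) (d a) := by
  -- The quotient rule does not depend on the fraction chosen: differentiate `a e = c b`.
  have key : ∀ a b c e : R, b ≠ 0 → e ≠ 0 → algebraMap R (FractionRing R) a / algebraMap R _ b =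
      algebraMap R _ c / algebraMap R _ e →
      (algebraMap R (FractionRing R) b * algebraMap R _ (d a)
        - algebraMap R _ a * algebraMap R _ (d b)) / algebraMap R _ b ^ 2 =
      (algebraMap R _ e * algebraMap R _ (d c)
        - algebraMap R _ c * algebraMap R _ (d e)) / algebraMap R _ e ^ 2 := by
    intro a b c e hb he h
    have inj := IsFractionRing.injective R (FractionRing R)
    have hb' : algebraMap R (FractionRing R) b ≠ 0 := by simpa using hb
    have he' : algebraMap R (FractionRing R) e ≠ 0 := by simpa using he
    rw [div_eq_div_iff hb' he', ← map_mul, ← map_mul] at h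
    have h0 := inj h
    have h1 := congrArg (fun r => algebraMap R (FractionRing R) (d r)) h0
    simp only [Derivation.leibniz, smul_eq_mul, map_add, map_mul] at h1
    rw [map_mul, map_mul] at h
    rw [div_eq_div_iff (pow_ne_zero 2 hb') (pow_ne_zero 2 he')]
    linear_combination (algebraMap R (FractionRing R) b * algebraMap R _ e) * h1 -
      (algebraMap R (FractionRing R) b * algebraMap R _ (d e)
        + algebraMap R _ e * algebraMap R _ (d b)) * h
  have ex : ∀ x : FractionRing R, ∃ y : FractionRing R, ∀ a b : R, b ≠ 0 →
      x = algebraMap R _ a / algebraMap R _ b →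
      y = (algebraMap R _ b * algebraMap R _ (d a)
        - algebraMap R _ a * algebraMap R _ (d b)) / algebraMap R _ b ^ 2 := by
    intro x
    obtain ⟨a, b, hb, rfl⟩ := IsFractionRing.div_surjective (A := R) x
    exact ⟨_, fun c e he h => key a b c e (nonZeroDivisors.ne_zero hb) he h⟩
  have rep : ∀ x : FractionRing R, ∃ a b : R, b ≠ 0 ∧ x = algebraMap R _ a / algebraMap R _ b := by
    intro x
    obtain ⟨a, b, hb, rfl⟩ := IsFractionRing.div_surjective (A := R) x
    exact ⟨a, b, nonZeroDivisors.ne_zero hb, rfl⟩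
  refine ⟨Derivation.mk'
    { toFun := fun x => (ex x).choose
      map_add' := by
        intro x y
        obtain ⟨a, b, hb, hx⟩ := rep x
        obtain ⟨c, e, he, hy⟩ := rep y
        have hb' : algebraMap R (FractionRing R) b ≠ 0 := by simpa using hb
        have he' : algebraMap R (FractionRing R) e ≠ 0 := by simpa using he
        rw [(ex x).choose_spec a b hb hx, (ex y).choose_spec c e he hy,
          (ex (x + y)).choose_spec (a * e + b * c) (b * e) (mul_ne_zero hb he)
            (by rw [hx, hy, map_add, map_mul, map_mul, map_mul, div_add_div _ _ hb' he'])]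
        simp only [Derivation.leibniz, smul_eq_mul, map_add, map_mul]
        field_simp
        ring
      map_smul' := by
        intro r x
        obtain ⟨a, b, hb, hx⟩ := rep x
        rw [(ex x).choose_spec a b hb hx, (ex (r • x)).choose_spec (r • a) b hb
            (by rw [hx, Algebra.smul_def, Algebra.smul_def, map_mul,
              ← IsScalarTower.algebraMap_apply, mul_div_assoc])]
        rw [d.map_smul, RingHom.id_apply]
        simp only [Algebra.smul_def, map_mul, ← IsScalarTower.algebraMap_apply]
        ring }
    (by
      intro x y
      obtain ⟨a, b, hb, hx⟩ := rep x
      obtain ⟨c, e, he, hy⟩ := rep y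
      have hb' : algebraMap R (FractionRing R) b ≠ 0 := by simpa using hb
      have he' : algebraMap R (FractionRing R) e ≠ 0 := by simpa using he
      simp only [LinearMap.coe_mk, AddHom.coe_mk, smul_eq_mul]
      rw [(ex x).choose_spec a b hb hx, (ex y).choose_spec c e he hy,
        (ex (x * y)).choose_spec (a * c) (b * e) (mul_ne_zero hb he)
          (by rw [hx, hy, map_mul, map_mul, div_mul_div_comm])]
      simp only [Derivation.leibniz, smul_eq_mul, map_add, map_mul, hx, hy]
      field_simp
      ring), fun a => ?_⟩
  exact ((ex _).choose_spec a 1 one_ne_zero (by simp)).trans (by simp)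

open MvPolynomial

/-- The coefficientwise action of a derivation on polynomials. -/
noncomputable def Derivation.mapPolynomial {K M : Type*} [CommRing K] [CommRing M] [Algebra K M]
    (d : Derivation K M M) : Derivation K (Polynomial M) (Polynomial M) :=
  PolynomialModule.equivPolynomialSelf.compDer d.mapCoeffs

theorem Derivation.coeff_mapPolynomial {K M : Type*} [CommRing K] [CommRing M] [Algebra K M]
    (d : Derivation K M M) (p : Polynomial M) (n : ℕ) :
    (d.mapPolynomial p).coeff n = d (p.coeff n) := rfl

/-- Two commuting derivations on a domain still commute on its field of fractions. -/
theorem Derivation.comm_of_fraction {K R M : Type*} [CommRing K] [CommRing R] [IsDomain R]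
    [Field M] [Algebra K M] [Algebra R M] [IsFractionRing R M]
    (d e : Derivation K M M)
    (h : ∀ a : R, d (e (algebraMap R M a)) = e (d (algebraMap R M a))) (x : M) :
    d (e x) = e (d x) := by
  have h' : ∀ a : R, ⁅d, e⁆ (algebraMap R M a) = 0 := fun a => by
    rw [Derivation.commutator_apply, h, sub_self]
  obtain ⟨a, b, hb, rfl⟩ := IsFractionRing.div_surjective (A := R) x
  rw [← sub_eq_zero, ← Derivation.commutator_apply, Derivation.leibniz_div, h', h']
  simp

/-! ### Partial derivatives in characteristic zero -/

namespace MvPolynomial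

theorem pderiv_comm {σ K : Type*} [CommRing K] (i j : σ) (p : MvPolynomial σ K) :
    pderiv i (pderiv j p) = pderiv j (pderiv i p) := by
  classical
  have : ⁅(pderiv i : Derivation K (MvPolynomial σ K) (MvPolynomial σ K)), pderiv j⁆ =
      (0 : Derivation K (MvPolynomial σ K) (MvPolynomial σ K)) := by
    apply derivation_ext
    intro k
    rw [Derivation.commutator_apply]
    simp [pderiv_X, Pi.single_apply, apply_ite]
  rw [← sub_eq_zero, ← Derivation.commutator_apply, this]
  rfl

variable {σ K : Type*} [Field K] [CharZero K]

theorem eq_zero_of_mem_support_of_pderiv_eq_zero {i : σ} {p : MvPolynomial σ K}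
    (hp : pderiv i p = 0) {s : σ →₀ ℕ} (hs : s ∈ p.support) : s i = 0 := by
  by_contra h
  have h1 := coeff_pderiv (i := i) p (s - Finsupp.single i 1)
  have h2 : s - Finsupp.single i 1 + Finsupp.single i 1 = s :=
    tsub_add_cancel_of_le (by rw [Finsupp.single_le_iff]; omega)
  rw [hp, h2, coeff_zero] at h1
  rcases mul_eq_zero.1 h1.symm with h3 | h3
  · exact (mem_support_iff.1 hs) h3
  · exact Nat.cast_add_one_ne_zero _ h3

theorem mem_supported_of_pderiv_eq_zero {p : MvPolynomial σ K} {S : Set σ}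
    (hp : ∀ i ∉ S, pderiv i p = 0) : p ∈ supported K S := by
  rw [mem_supported]
  intro i hi
  by_contra h
  obtain ⟨s, hs, his⟩ := mem_vars_iff_mem_support i |>.1 hi
  exact (Finsupp.mem_support_iff.1 his) (eq_zero_of_mem_support_of_pderiv_eq_zero (hp i h) hs)

theorem eq_C_of_pderiv_eq_zero {p : MvPolynomial σ K} (hp : ∀ i, pderiv i p = 0) :
    ∃ c, p = C c := by
  have h : p ∈ supported K (∅ : Set σ) := mem_supported_of_pderiv_eq_zero fun i _ => hp i
  rw [supported_empty, Algebra.mem_bot] at h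
  obtain ⟨c, hc⟩ := h
  exact ⟨c, hc.symm⟩

theorem eq_of_pderiv_eq {p q : MvPolynomial σ K} (hp : ∀ i, pderiv i p = pderiv i q)
    (h0 : constantCoeff p = constantCoeff q) : p = q := by
  obtain ⟨c, hc⟩ := eq_C_of_pderiv_eq_zero (p := p - q) fun i => by rw [map_sub, hp, sub_self]
  have h1 := congrArg constantCoeff hc
  rw [map_sub, h0, sub_self, constantCoeff_C] at h1
  rwa [← h1, C_0, sub_eq_zero] at hc

theorem degreeOf_pderiv_le {σ K : Type*} [Field K] {i : σ} {p : MvPolynomial σ K}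
    {n : ℕ} (h : degreeOf i p ≤ n + 1) :
    degreeOf i (pderiv i p) ≤ n := by
  rw [degreeOf_le_iff] at h ⊢
  intro s hs
  have h1 := h (s + Finsupp.single i 1) (by
    rw [mem_support_iff, coeff_pderiv] at *
    exact left_ne_zero_of_mul hs)
  simp at h1
  omega

theorem pderiv_eq_zero_of_degreeOf_eq_zero {σ K : Type*} [Field K] {i : σ}
    {p : MvPolynomial σ K} (h : degreeOf i p = 0) :
    pderiv i p = 0 :=
  pderiv_eq_zero_of_notMem_vars (by simpa [mem_vars_iff_degreeOf_ne_zero] using h)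

theorem derivation_aeval {σ K A M : Type*} [Fintype σ] [CommRing K] [CommRing A] [Algebra K A]
    [AddCommGroup M] [Module A M] [Module K M] [IsScalarTower K A M]
    (D : Derivation K A M) (f : σ → A) (p : MvPolynomial σ K) :
    D (aeval f p) = ∑ i, aeval f (pderiv i p) • D (f i) := by
  classical
  induction p using MvPolynomial.induction_on with
  | C a => simp
  | add p q hp hq => simp [hp, hq, add_smul, Finset.sum_add_distrib]
  | mul_X p j hp =>
    simp only [map_mul, aeval_X, Derivation.leibniz, hp, smul_eq_mul, map_add, add_smul,
      Finset.sum_add_distrib, pderiv_X, Pi.single_apply, Finset.smul_sum, mul_smul]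
    congr 1
    rw [Finset.sum_eq_single j] <;> simp +contextual [eq_comm]

end MvPolynomial

/-! ### Level curves as flow lines -/

/-- The derivation `∂x - (∂x u / ∂y u) ∂y` annihilating `u` commutes with `(∂y u)⁻¹ ∂y`. -/
theorem Derivation.levelDerivation_comm {K M : Type*} [CommRing K] [Field M] [Algebra K M]
    (dx dy E : Derivation K M M) (hc : ∀ a, dx (dy a) = dy (dx a)) (u m : M) (hu : dy u ≠ 0)
    (hE : ∀ f, E f = dx f + m * dy f) (hEu : E u = 0) (f : M) :
    E (dy f / dy u) = dy (E f) / dy u := by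
  have h : ∀ f, E (dy f) = dy (E f) - dy m * dy f := fun f => by
    rw [hE f, hE, map_add, Derivation.leibniz, hc, smul_eq_mul, smul_eq_mul]
    ring
  rw [Derivation.leibniz_div, h, h u, hEu, map_zero, smul_eq_mul, smul_eq_mul]
  field_simp
  ring

/-- If `E` is a derivation with `E x = 1`, `E³ y = 0`, `E z = 0` and `E u = 0`, then `u` is invariant
under the flow of `E`. -/
theorem MvPolynomial.aeval_flow_eq_C {K M : Type*} [Field K] [CharZero K] [Field M] [Algebra K M]
    (E : Derivation K M M) (x y z m l : M) (p : MvPolynomial (Fin 3) K)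
    (hx : E x = 1) (hy : E y = m) (hz : E z = 0) (hm : E m = -l) (hl : E l = 0)
    (hp : E (aeval ![x, y, z] p) = 0) :
    aeval ![Polynomial.C x + Polynomial.X,
      Polynomial.C y + Polynomial.C m * Polynomial.X - Polynomial.C (l / 2) * Polynomial.X ^ 2,
      Polynomial.C z] p = Polynomial.C (aeval ![x, y, z] p) := by
  have : CharZero M := charZero_of_injective_algebraMap (algebraMap K M).injective
  set f : Fin 3 → Polynomial M := ![Polynomial.C x + Polynomial.X,
      Polynomial.C y + Polynomial.C m * Polynomial.X - Polynomial.C (l / 2) * Polynomial.X ^ 2,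
      Polynomial.C z] with hf
  have hC : ∀ a : M, E.mapPolynomial (Polynomial.C a) = Polynomial.C (E a) := fun a => by
    ext n
    rw [Derivation.coeff_mapPolynomial, Polynomial.coeff_C, Polynomial.coeff_C]
    split_ifs <;> simp
  have hX : E.mapPolynomial Polynomial.X = 0 := by
    ext n
    rw [Derivation.coeff_mapPolynomial, Polynomial.coeff_X]
    split_ifs <;> simp
  have hl2 : E (l / 2) = 0 := by
    rw [Derivation.leibniz_div, hl, show (2 : M) = ((2 : ℕ) : M) by norm_num,
      Derivation.map_natCast]
    simp
  -- By the chain rule it suffices to check the three coordinates: on the flow, `d/dt` agrees with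
  -- `E` applied to coefficients.
  have key : ∀ q : MvPolynomial (Fin 3) K,
      Polynomial.derivative (aeval f q) = E.mapPolynomial (aeval f q) := by
    intro q
    have h2 : (Polynomial.C (2 : M)) = 2 := rfl
    have h1 : ∀ i, Polynomial.derivative (f i) = E.mapPolynomial (f i) := by
      intro i
      have h3 : Polynomial.C l = Polynomial.C (l / 2) * 2 := by
        rw [← h2, ← map_mul]; congr 1; field_simp
      fin_cases i <;> simp [hf, hC, hX, hx, hy, hz, hm, hl2]
      rw [h3]; ring
    have h4 := derivation_aeval ((Polynomial.derivative' (R := M)).restrictScalars K) f q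
    have h5 := derivation_aeval E.mapPolynomial f q
    rw [h5, ← Finset.sum_congr rfl fun i _ => by rw [← h1 i]]
    exact h4
  have h0 : (aeval f p).coeff 0 = aeval ![x, y, z] p := by
    have h6 : ((Polynomial.aeval (R := M) (0 : M)).restrictScalars K).comp (aeval f)
        = aeval ![x, y, z] := by
      apply algHom_ext
      intro i
      fin_cases i <;> simp [hf]
    have h7 := DFunLike.congr_fun h6 p
    simpa [Polynomial.coeff_zero_eq_eval_zero] using h7
  have hn : ∀ n, (aeval f p).coeff (n + 1) = 0 := by
    -- Coefficients in `t` satisfy `(n + 1) c_{n+1} = E c_n`, so `E c₀ = 0` kills all the higher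
    -- ones.
    have hs : ∀ n, (aeval f p).coeff (n + 1) * (n + 1) = E ((aeval f p).coeff n) := fun n => by
      rw [← Polynomial.coeff_derivative, key, Derivation.coeff_mapPolynomial]
    intro n
    have hne : ((n : M) + 1) ≠ 0 := Nat.cast_add_one_ne_zero n
    refine (mul_eq_zero.1 ((hs n).trans ?_)).resolve_right hne
    induction n with
    | zero => rw [h0, hp]
    | succ n ih =>
      have := (mul_eq_zero.1 ((hs n).trans (ih (Nat.cast_add_one_ne_zero n)))).resolve_right
        (Nat.cast_add_one_ne_zero n)
      rw [this, map_zero]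
  ext n
  rcases n with _ | n
  · rw [h0, Polynomial.coeff_C_zero]
  · rw [hn, Polynomial.coeff_C_succ]

/-! ### Leading coefficients of level curves -/

/-- If a bivariate polynomial is constant along a polynomial curve `(x + t, Y(t))` with
`deg Y ≤ w`, then the coefficient of `t ^ w` in `Y` is algebraic over the base field. -/
theorem MvPolynomial.isAlgebraic_coeff_of_aeval_eq_C {K M : Type*} [Field K] [Field M] [Algebra K M]
    {p : MvPolynomial (Fin 3) K} (hs : ∀ s ∈ p.support, s 2 = 0) (hne : ∀ c, p ≠ C c)
    {x c : M} {Y Z : Polynomial M} {w : ℕ} (hw : 0 < w) (hY : Y.natDegree ≤ w)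
    (h : aeval ![Polynomial.C x + Polynomial.X, Y, Z] p = Polynomial.C c) :
    IsAlgebraic K (Y.coeff w) := by
  classical
  have hsup : p.support.Nonempty := by
    rw [Finset.nonempty_iff_ne_empty, Ne, support_eq_empty]
    exact fun h0 => hne 0 (by rw [h0, C_0])
  -- Give `x` weight `1` and `y` weight `w`; `D` is the top weighted degree.
  obtain ⟨s₀, hs₀, hmax⟩ := Finset.exists_max_image p.support (fun s => s 0 + w * s 1) hsup
  set D := s₀ 0 + w * s₀ 1 with hD
  have hDpos : D ≠ 0 := by
    intro hD0
    apply hne (coeff 0 p)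
    ext s
    rw [coeff_C]
    split_ifs with h0
    · rw [h0]
    · by_contra hcs
      have h1 := hmax s (mem_support_iff.2 hcs)
      have h2 := hs s (mem_support_iff.2 hcs)
      rw [hD0] at h1
      have h3 : s 0 = 0 := by omega
      have h4 : s 1 = 0 := by
        have : w * s 1 = 0 := by omega
        exact (Nat.mul_eq_zero.1 this).resolve_left hw.ne'
      apply h0
      ext i
      fin_cases i <;> simp [h2, h3, h4]
  have hlin : (Polynomial.C x + Polynomial.X).natDegree ≤ 1 := by
    rw [add_comm]; exact (Polynomial.natDegree_X_add_C x).le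
  have hdeg : ∀ s : Fin 3 →₀ ℕ,
      ((Polynomial.C x + Polynomial.X) ^ s 0 * Y ^ s 1).natDegree ≤ s 0 + w * s 1 := by
    intro s
    refine Polynomial.natDegree_mul_le_of_le ((Polynomial.natDegree_pow_le_of_le _ hlin).trans ?_)
      ((Polynomial.natDegree_pow_le_of_le _ hY).trans ?_)
    · simp
    · rw [mul_comm]
  have htop : ∀ s : Fin 3 →₀ ℕ,
      ((Polynomial.C x + Polynomial.X) ^ s 0 * Y ^ s 1).coeff (s 0 + w * s 1)
        = Y.coeff w ^ s 1 := by
    intro s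
    have e1 : ((Polynomial.C x + Polynomial.X) ^ s 0).natDegree ≤ s 0 := by
      simpa only [mul_one] using Polynomial.natDegree_pow_le_of_le (s 0) hlin
    have e2 : (Y ^ s 1).natDegree ≤ w * s 1 := by
      simpa [mul_comm] using Polynomial.natDegree_pow_le_of_le (s 1) hY
    rw [Polynomial.coeff_mul_add_eq_of_natDegree_le e1 e2]
    have e3 := Polynomial.coeff_pow_of_natDegree_le (m := s 0) hlin
    have e4 := Polynomial.coeff_pow_of_natDegree_le (m := s 1) hY
    rw [mul_one] at e3
    rw [e3, mul_comm w, mul_comm, mul_comm (s 1), mul_comm w, e4]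
    simp
  -- `Q` is the top weighted form at `x = 1`. Its value at the leading coefficient of `Y` is the
  -- coefficient of `t ^ D`, which vanishes. At fixed weight the `y`-exponent determines the
  -- monomial, so nothing cancels in `Q`.
  set Q : Polynomial K := ∑ s ∈ p.support with s 0 + w * s 1 = D,
    Polynomial.monomial (s 1) (coeff s p) with hQ
  refine ⟨Q, ?_, ?_⟩
  · intro hQ0
    have h1 : Q.coeff (s₀ 1) = coeff s₀ p := by
      rw [hQ, Polynomial.finsetSum_coeff, Finset.sum_eq_single s₀]
      · simp
      · intro s hs1 hne1
        rw [Finset.mem_filter] at hs1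
        rw [Polynomial.coeff_monomial, if_neg]
        intro h1
        apply hne1
        have h2 := hs s hs1.1
        have h3 := hs s₀ hs₀
        have h4 : s 0 = s₀ 0 := by
          have := hs1.2
          rw [h1] at this
          omega
        ext i
        fin_cases i <;> simp [h1, h2, h3, h4]
      · intro hh
        exact absurd (Finset.mem_filter.2 ⟨hs₀, hD.symm⟩) hh
    rw [hQ0, Polynomial.coeff_zero] at h1
    exact mem_support_iff.1 hs₀ h1.symm
  · have h1 := congrArg (fun q => Polynomial.coeff q D) h
    simp only [Polynomial.coeff_C, if_neg hDpos] at h1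
    rw [← h1, aeval_def, eval₂_eq', Polynomial.finsetSum_coeff, hQ, map_sum, Finset.sum_filter]
    refine Finset.sum_congr rfl fun s hs1 => ?_
    rw [Fin.prod_univ_three]
    simp only [Matrix.cons_val_zero, Matrix.cons_val_one, Matrix.cons_val_two,
      hs s hs1, pow_zero, mul_one]
    rw [IsScalarTower.algebraMap_apply K M (Polynomial M), Polynomial.algebraMap_eq,
      Polynomial.coeff_C_mul]
    split_ifs with h2
    · rw [← h2, htop, Polynomial.aeval_monomial]
    · rw [Polynomial.coeff_eq_zero_of_natDegree_lt, mul_zero]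
      exact (hdeg s).trans_lt (lt_of_le_of_ne (hmax s hs1) h2)

/-- An algebraically closed field is algebraically closed in every field extension. -/
theorem IsAlgClosed.mem_range_algebraMap_of_isAlgebraic {K M : Type*} [Field K] [IsAlgClosed K]
    [Field M] [Algebra K M] {x : M} (hx : IsAlgebraic K x) : ∃ c, algebraMap K M c = x := by
  have hi : IsIntegral K x := hx.isIntegral
  have h := IsAlgClosed.degree_eq_one_of_irreducible K (minpoly.irreducible hi)
  exact minpoly.mem_range_of_degree_eq_one K x h

/-! ### Shears -/

/-- The substitutions `y ↦ y - b(x)` and `y ↦ y + b(x)` are mutually inverse. -/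
theorem MvPolynomial.aeval_shear_aeval_shear {K : Type*} [Field K] (b : Polynomial K)
    (p : MvPolynomial (Fin 3) K) :
    aeval ![X 0, X 1 + Polynomial.aeval (X 0 : MvPolynomial (Fin 3) K) b, X 2]
      (aeval ![X 0, X 1 - Polynomial.aeval (X 0 : MvPolynomial (Fin 3) K) b, X 2] p) = p := by
  have h : (aeval ![X 0, X 1 + Polynomial.aeval (X 0 : MvPolynomial (Fin 3) K) b, X 2]).comp
      (aeval ![X 0, X 1 - Polynomial.aeval (X 0 : MvPolynomial (Fin 3) K) b, X 2])
      = AlgHom.id K (MvPolynomial (Fin 3) K) := by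
    apply algHom_ext
    intro i
    fin_cases i <;> simp [← Polynomial.aeval_algHom_apply]
  exact DFunLike.congr_fun h p

theorem MvPolynomial.pderiv_two_aeval_shear {K : Type*} [Field K] (b : Polynomial K)
    {p : MvPolynomial (Fin 3) K} (hp : pderiv 2 p = 0) :
    pderiv 2 (aeval ![X 0, X 1 - Polynomial.aeval (X 0 : MvPolynomial (Fin 3) K) b, X 2] p)
      = 0 := by
  have h : pderiv 2 (Polynomial.aeval (X 0 : MvPolynomial (Fin 3) K) b) = 0 := by
    rw [Derivation.map_aeval]
    simp [pderiv_X]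
  rw [derivation_aeval]
  simp [Fin.sum_univ_three, hp, h, pderiv_X]

theorem MvPolynomial.pderiv_zero_aeval_shear {K : Type*} [Field K] (b : Polynomial K)
    {p : MvPolynomial (Fin 3) K}
    (hp : pderiv 0 p = Polynomial.aeval (X 0 : MvPolynomial (Fin 3) K) b.derivative * pderiv 1 p) :
    pderiv 0 (aeval ![X 0, X 1 - Polynomial.aeval (X 0 : MvPolynomial (Fin 3) K) b, X 2] p)
      = 0 := by
  have h : pderiv 0 (Polynomial.aeval (X 0 : MvPolynomial (Fin 3) K) b)
      = Polynomial.aeval (X 0 : MvPolynomial (Fin 3) K) b.derivative := by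
    rw [Derivation.map_aeval]
    simp
  rw [derivation_aeval]
  simp [Fin.sum_univ_three, hp, h, pderiv_X, ← Polynomial.aeval_algHom_apply]
  ring

/-! ### Level curves of `u` are parabolas -/

theorem MvPolynomial.exists_parabolic_level_curves_of_fractionRing {K : Type*} [Field K]
    [IsAlgClosed K] [CharZero K] {M : Type*} [Field M] [Algebra K M] [Algebra (MvPolynomial (Fin 3) K) M]
    [IsScalarTower K (MvPolynomial (Fin 3) K) M] [IsFractionRing (MvPolynomial (Fin 3) K) M]
    (dx dy : Derivation K M M)
    (hdx : ∀ a, dx (algebraMap (MvPolynomial (Fin 3) K) M a) = algebraMap _ M (pderiv 0 a))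
    (hdy : ∀ a, dy (algebraMap (MvPolynomial (Fin 3) K) M a) = algebraMap _ M (pderiv 1 a))
    {u w k : MvPolynomial (Fin 3) K} (hu : pderiv 1 u ≠ 0) (huz : pderiv 2 u = 0)
    {c : K} (hwz : pderiv 2 w = C c) (hw : pderiv 1 w = pderiv 0 u)
    (hk : pderiv 1 u * pderiv 0 w - pderiv 0 u ^ 2 = pderiv 1 k)
    (hJ : pderiv 0 u * pderiv 1 k = pderiv 1 u * pderiv 0 k) :
    ∃ l μ ρ : K, pderiv 0 u = (C l * X 0 + C μ) * pderiv 1 u ∧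
      pderiv 0 w - (C l * X 0 + C μ) * pderiv 0 u = C l * u + C ρ := by
  obtain ⟨φ, hφ⟩ : ∃ φ : MvPolynomial (Fin 3) K →+* M, φ = algebraMap (MvPolynomial (Fin 3) K) M :=
    ⟨_, rfl⟩
  have hc : ∀ a, dx (dy a) = dy (dx a) :=
    Derivation.comm_of_fraction (R := MvPolynomial (Fin 3) K) dx dy fun a => by
      rw [hdy, hdx, hdx, hdy, pderiv_comm]
  rw [← hφ] at hdx hdy
  have inj : Function.Injective φ := hφ ▸ IsFractionRing.injective (MvPolynomial (Fin 3) K) M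
  have hCM : ∀ a : K, φ (C a) = algebraMap K M a := fun a => by
    rw [hφ]; exact (IsScalarTower.algebraMap_apply K (MvPolynomial (Fin 3) K) M a).symm
  have hu' : φ (pderiv 1 u) ≠ 0 := fun h => hu (inj (h.trans (map_zero φ).symm))
  have hduy : dy (φ u) ≠ 0 := by rw [hdy]; exact hu'
  obtain ⟨m, hm⟩ : ∃ m, m = -φ (pderiv 0 u) / φ (pderiv 1 u) := ⟨_, rfl⟩
  have hmu : m * φ (pderiv 1 u) = -φ (pderiv 0 u) := by rw [hm]; field_simp
  -- With `d/du = u_y⁻¹ ∂y`, these are `r = dk/du` and `l = dr/du`; commutation with `E` yields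
  -- their `E`-derivatives.
  obtain ⟨r, hr⟩ : ∃ r, r = dy (φ k) / dy (φ u) := ⟨_, rfl⟩
  obtain ⟨l, hl⟩ : ∃ l, l = dy r / dy (φ u) := ⟨_, rfl⟩
  obtain ⟨E, hE⟩ : ∃ E : Derivation K M M, ∀ f, E f = dx f + m * dy f :=
    ⟨dx + m • dy, fun f => rfl⟩
  have hEu : E (φ u) = 0 := by rw [hE, hdx, hdy, hmu]; ring
  have comm := Derivation.levelDerivation_comm dx dy E hc (φ u) m hduy hE hEu
  have hk' := congrArg φ hk
  have hJ' := congrArg φ hJ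
  simp only [map_mul, map_sub, map_pow] at hk' hJ'
  have hEk : E (φ k) = 0 := by
    apply mul_left_cancel₀ hu'
    rw [hE, hdx, hdy, mul_zero]
    linear_combination φ (pderiv 1 k) * hmu - hJ'
  have hrr : r * φ (pderiv 1 u) = φ (pderiv 1 k) := by rw [hr, hdy, hdy]; field_simp
  have hEw : E (φ w) = r := by
    apply mul_left_cancel₀ hu'
    rw [hE, hdx, hdy, hw]
    linear_combination φ (pderiv 0 u) * hmu - hrr + hk'
  have hEr : E r = 0 := by rw [hr, comm, hEk, map_zero, zero_div]
  have hEl : E l = 0 := by rw [hl, comm, hEr, map_zero, zero_div]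
  have hEm : E m = -l := by
    have : m = -(dy (φ w) / dy (φ u)) := by rw [hm, hdy, hdy, hw]; ring
    rw [this, map_neg, comm, hEw, hl]
  have hdX : ∀ i, E (φ (X i)) = φ (pderiv 0 (X i)) + m * φ (pderiv 1 (X i)) := fun i => by
    rw [hE, hdx, hdy]
  have hae : ∀ p : MvPolynomial (Fin 3) K, aeval ![φ (X 0), φ (X 1), φ (X 2)] p = φ p := by
    have : aeval ![φ (X 0), φ (X 1), φ (X 2)] =
        IsScalarTower.toAlgHom K (MvPolynomial (Fin 3) K) M := by
      apply algHom_ext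
      intro i
      fin_cases i <;> simp [hφ]
    intro p
    rw [this, hφ]
    rfl
  have flow := aeval_flow_eq_C E (φ (X 0)) (φ (X 1)) (φ (X 2)) m l u
    (by rw [hdX]; simp [pderiv_X]) (by rw [hdX]; simp [pderiv_X]) (by rw [hdX]; simp [pderiv_X])
    hEm hEl (by rw [hae, hEu])
  rw [hae] at flow
  have hsup : ∀ s ∈ u.support, s 2 = 0 := fun s hs =>
    eq_zero_of_mem_support_of_pderiv_eq_zero huz hs
  have hne : ∀ c, u ≠ C c := fun c h => hu (by rw [h, pderiv_C])
  -- The coefficient of `t²` on the flow is `-l / 2`.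
  have halg := isAlgebraic_coeff_of_aeval_eq_C hsup hne (w := 2) two_pos (by compute_degree) flow
  obtain ⟨c₂, hc₂⟩ := IsAlgClosed.mem_range_algebraMap_of_isAlgebraic halg
  have hM0 : CharZero M := charZero_of_injective_algebraMap (algebraMap K M).injective
  obtain ⟨l₀, hl₀⟩ : ∃ l₀, l = algebraMap K M l₀ := by
    refine ⟨-2 * c₂, ?_⟩
    rw [map_mul, hc₂]
    simp
    field_simp
    rw [map_ofNat]
  -- In the coordinate `y + (l / 2) x²` the parabola becomes a line of slope `m + l x`, so weight
  -- `1` now applies.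
  set b : Polynomial K := Polynomial.C (l₀ / 2) * Polynomial.X ^ 2 with hb
  set q : MvPolynomial (Fin 3) K :=
    aeval ![X 0, X 1 - Polynomial.aeval (X 0 : MvPolynomial (Fin 3) K) b, X 2] u with hq
  have flow' : aeval ![Polynomial.C (φ (X 0)) + Polynomial.X,
      Polynomial.C (φ (X 1) + l / 2 * φ (X 0) ^ 2) + Polynomial.C (m + l * φ (X 0)) * Polynomial.X,
      Polynomial.C (φ (X 2))] q = Polynomial.C (φ u) := by
    rw [← flow, hq, ← AlgHom.comp_apply, comp_aeval]
    congr 2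
    have h2 : Polynomial.C l = 2 * Polynomial.C (l / 2) := by
      rw [show (2 : Polynomial M) = Polynomial.C 2 from rfl, ← map_mul]
      congr 1; field_simp
    have h3 : algebraMap K (Polynomial M) (l₀ / 2) = Polynomial.C (l / 2) := by
      rw [IsScalarTower.algebraMap_apply K M, map_div₀, ← hl₀, map_ofNat]
      rfl
    funext i
    fin_cases i <;> simp [hb, h3]
    rw [h2]; ring
  have hqne : ∀ c, q ≠ C c := by
    intro c h
    apply hne c
    rw [← aeval_shear_aeval_shear b u, ← hq, h]
    simp
  have hqs : ∀ s ∈ q.support, s 2 = 0 := fun s hs =>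
    eq_zero_of_mem_support_of_pderiv_eq_zero (pderiv_two_aeval_shear b huz) hs
  have halg' := isAlgebraic_coeff_of_aeval_eq_C hqs hqne (w := 1) one_pos (by compute_degree) flow'
  obtain ⟨c₁, hc₁⟩ := IsAlgClosed.mem_range_algebraMap_of_isAlgebraic halg'
  have hc₁' : φ (C c₁) = m + l * φ (X 0) := by
    rw [hCM, hc₁, Polynomial.coeff_add, Polynomial.coeff_C_succ, Polynomial.coeff_C_mul,
      Polynomial.coeff_X_one, zero_add, mul_one]
  have hlC : φ (C l₀) = l := by rw [hCM, hl₀]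
  have hmC : φ (C l₀ * X 0 + C (-c₁)) = -m := by
    rw [map_add, map_mul, C_neg, map_neg, hc₁', hlC]; ring
  have e1 : pderiv 0 u = (C l₀ * X 0 + C (-c₁)) * pderiv 1 u := by
    apply inj
    rw [map_mul, hmC]
    linear_combination hmu
  -- Since `m` is now a polynomial, `r = E w` is one too; `r - l u` has zero gradient, whence `ρ`.
  set r₀ := pderiv 0 w - (C l₀ * X 0 + C (-c₁)) * pderiv 0 u with hr₀
  have hr₀r : φ r₀ = r := by
    rw [hr₀, map_sub, map_mul, hmC, ← hEw, hE, hdx, hdy, hw]; ring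
  have hry : pderiv 1 r₀ = C l₀ * pderiv 1 u := by
    apply inj
    rw [← hdy, hr₀r, map_mul, hlC, ← hdy, hl]
    field_simp
  have hrx : pderiv 0 r₀ = C l₀ * pderiv 0 u := by
    apply inj
    have h1 : dx r + m * dy r = 0 := by rw [← hE, hEr]
    rw [← hr₀r, hdx, hdy, hry, map_mul, hlC] at h1
    rw [map_mul, hlC]
    linear_combination h1 - l * hmu
  have hrz : pderiv 2 r₀ = 0 := by
    rw [hr₀, map_sub, pderiv_comm, hwz, pderiv_mul, pderiv_comm 2 0, huz]
    simp [pderiv_X]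
  obtain ⟨ρ, hρ⟩ := eq_C_of_pderiv_eq_zero (p := r₀ - C l₀ * u) (by
    intro i
    fin_cases i <;> simp [hrx, hry, hrz, huz])
  exact ⟨l₀, -c₁, ρ, e1, by rw [← hρ]; ring⟩

/-- The level curves of `u` are translates of one parabola. -/
theorem MvPolynomial.exists_parabolic_level_curves {K : Type*} [Field K] [IsAlgClosed K]
    [CharZero K] {u w k : MvPolynomial (Fin 3) K} (hu : pderiv 1 u ≠ 0) (huz : pderiv 2 u = 0)
    {c : K} (hwz : pderiv 2 w = C c) (hw : pderiv 1 w = pderiv 0 u)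
    (hk : pderiv 1 u * pderiv 0 w - pderiv 0 u ^ 2 = pderiv 1 k)
    (hJ : pderiv 0 u * pderiv 1 k = pderiv 1 u * pderiv 0 k) :
    ∃ l μ ρ : K, pderiv 0 u = (C l * X 0 + C μ) * pderiv 1 u ∧
      pderiv 0 w - (C l * X 0 + C μ) * pderiv 0 u = C l * u + C ρ := by
  obtain ⟨dx, hdx⟩ := Derivation.exists_extension_fractionRing
    (pderiv 0 : Derivation K (MvPolynomial (Fin 3) K) (MvPolynomial (Fin 3) K))
  obtain ⟨dy, hdy⟩ := Derivation.exists_extension_fractionRing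
    (pderiv 1 : Derivation K (MvPolynomial (Fin 3) K) (MvPolynomial (Fin 3) K))
  exact exists_parabolic_level_curves_of_fractionRing dx dy hdx hdy hu huz hwz hw hk hJ

/-! ### Constancy of `v_z` -/

/-- If `f ∈ K[x, z]` is nonconstant in `z` and `u_y f_x + f_z h_y = 0`, then `h` is, up to a
constant, a scalar multiple of `u`. -/
theorem MvPolynomial.exists_pderiv_eq_C_mul {K : Type*} [Field K] [CharZero K]
    {u h : MvPolynomial (Fin 3) K} (hu : pderiv 1 u ≠ 0) (huz : pderiv 2 u = 0)
    (hhz : pderiv 2 h = 0) (hJ : pderiv 0 u * pderiv 1 h = pderiv 1 u * pderiv 0 h) (n : ℕ) :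
    ∀ f : MvPolynomial (Fin 3) K, degreeOf 2 f ≤ n → pderiv 1 f = 0 →
      pderiv 1 u * pderiv 0 f + pderiv 2 f * pderiv 1 h = 0 → pderiv 2 f ≠ 0 →
      ∃ c, ∀ i, pderiv i h = C c * pderiv i u := by
  induction n with
  | zero => exact fun f hf _ _ hz => absurd (pderiv_eq_zero_of_degreeOf_eq_zero (by omega)) hz
  | succ n ih =>
    intro f hf hy hrel hz
    have huyz : pderiv 2 (pderiv 1 u) = 0 := by rw [pderiv_comm, huz, map_zero]
    have hhyz : pderiv 2 (pderiv 1 h) = 0 := by rw [pderiv_comm, hhz, map_zero]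
    have hrel' := congrArg (pderiv 2) hrel
    simp only [map_add, pderiv_mul, huyz, hhyz, map_zero, zero_mul, zero_add,
      mul_zero, add_zero] at hrel'
    rw [pderiv_comm 2 0] at hrel'
    have hy' : pderiv 1 (pderiv 2 f) = 0 := by rw [pderiv_comm, hy, map_zero]
    by_cases hzz : pderiv 2 (pderiv 2 f) = 0
    -- Here `f_z` is a nonzero constant `a`, so `∇h = q ∇u` with `q = -f_x / a` depending on `x`
    -- only; equality of mixed derivatives gives `q_x u_y = 0`.
    · rw [hzz, zero_mul, add_zero] at hrel'
      have hx' := (mul_eq_zero.1 hrel').resolve_left hu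
      obtain ⟨a, ha⟩ := eq_C_of_pderiv_eq_zero (p := pderiv 2 f) (by
        intro i
        fin_cases i <;> simp [hx', hy', hzz])
      have ha0 : a ≠ 0 := by
        rintro rfl
        exact hz (by rw [ha, C_0])
      have haa : C a⁻¹ * C a = (1 : MvPolynomial (Fin 3) K) := by
        rw [← C_mul, inv_mul_cancel₀ ha0, C_1]
      obtain ⟨q, hq⟩ : ∃ q, q = -(C a⁻¹ * pderiv 0 f) := ⟨_, rfl⟩
      have h1 : pderiv 1 h = q * pderiv 1 u := by
        rw [ha] at hrel
        rw [hq]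
        linear_combination C a⁻¹ * hrel - pderiv 1 h * haa
      have h0 : pderiv 0 h = q * pderiv 0 u := by
        apply mul_left_cancel₀ hu
        linear_combination pderiv 0 u * h1 - hJ
      have hqy : pderiv 1 q = 0 := by
        rw [hq, map_neg, pderiv_C_mul, pderiv_comm, hy, map_zero, mul_zero, neg_zero]
      have hqz : pderiv 2 q = 0 := by
        rw [hq, map_neg, pderiv_C_mul, pderiv_comm, ha, pderiv_C, mul_zero, neg_zero]
      have hqx : pderiv 0 q = 0 := by
        have e1 := congrArg (pderiv 0) h1
        have e2 := congrArg (pderiv 1) h0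
        rw [pderiv_mul] at e1 e2
        rw [pderiv_comm 1 0 h, pderiv_comm 1 0 u, hqy] at e2
        refine (mul_eq_zero.1 ?_).resolve_right hu
        linear_combination e2 - e1
      obtain ⟨c, hc⟩ := eq_C_of_pderiv_eq_zero (p := q) (by
        intro i
        fin_cases i <;> simp [hqx, hqy, hqz])
      refine ⟨c, fun i => ?_⟩
      rw [← hc]
      fin_cases i <;> simp [h0, h1, huz, hhz]
    -- The `z`-derivative of the relation is the same relation for `f_z`, of lower degree in `z`.
    · exact ih _ (degreeOf_pderiv_le hf) hy' hrel' hzz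

/-! ### Nilpotent Jacobians and the main theorem -/

/-- The elementary symmetric functions of a nilpotent `3 × 3` matrix vanish. -/
theorem Matrix.invariants_eq_zero_of_isNilpotent {R : Type*} [CommRing R] [IsDomain R] [CharZero R]
    {A : Matrix (Fin 3) (Fin 3) R} (hA : IsNilpotent A) :
    A 0 0 + A 1 1 + A 2 2 = 0 ∧
    A 0 0 * A 1 1 - A 0 1 * A 1 0 + (A 0 0 * A 2 2 - A 0 2 * A 2 0)
      + (A 1 1 * A 2 2 - A 1 2 * A 2 1) = 0 ∧ A.det = 0 := by
  have h1 : A.trace = 0 := (Matrix.isNilpotent_trace_of_isNilpotent hA).eq_zero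
  have h2 : (A * A).trace = 0 := by
    have : IsNilpotent (A * A) := by
      rw [← pow_two]
      exact hA.pow_of_pos two_ne_zero
    exact (Matrix.isNilpotent_trace_of_isNilpotent this).eq_zero
  rw [Matrix.trace_fin_three] at h1 h2
  refine ⟨h1, ?_, ?_⟩
  · simp only [Matrix.mul_apply, Fin.sum_univ_three] at h2
    have h3 : (2 : R) ≠ 0 := two_ne_zero
    apply mul_left_cancel₀ h3
    linear_combination (A 0 0 + A 1 1 + A 2 2) * h1 - h2
  · obtain ⟨n, hn⟩ := hA
    have h3 : IsNilpotent A.det := ⟨n, by rw [← Matrix.det_pow, hn, Matrix.det_zero]⟩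
    exact h3.eq_zero

/-- The variables `x, y, z` are `X 0, X 1, X 2`; `supported K {0, 1}` is `K[x, y]`.
The proof does not use the bound on `gcd (deg_y u) (deg_y h)`. -/
theorem theorem2p2 {K : Type*} [Field K] [IsAlgClosed K] [CharZero K]
    (u v h : MvPolynomial (Fin 3) K)
    (hu : u ∈ MvPolynomial.supported K ({0, 1} : Set (Fin 3)))
    (hh : h ∈ MvPolynomial.supported K ({0, 1} : Set (Fin 3)))
    (hzero : ∀ i, MvPolynomial.eval (0 : Fin 3 → K) (![u, v, h] i) = 0)
    (hind : LinearIndependent K ![u, v, h])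
    (hnil : IsNilpotent (polyJacobian ![u, v, h]))
    (hgcd : Nat.gcd (MvPolynomial.degreeOf 1 u) (MvPolynomial.degreeOf 1 h) ≤ 3) :
    ∃ (v₁ c₀ a l₁ l₂ l₂' : K) (g b : Polynomial K),
      v₁ ≠ 0 ∧ c₀ ≠ 0 ∧ a ≠ 0 ∧ g.eval 0 = 0 ∧ 1 ≤ g.natDegree ∧
      b = Polynomial.C (v₁ * c₀ * a) * Polynomial.X ^ 2 + Polynomial.C l₁ * Polynomial.X
            + Polynomial.C l₂' ∧
      u = Polynomial.aeval (MvPolynomial.C a * MvPolynomial.X 1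
            + Polynomial.aeval (MvPolynomial.X 0 : MvPolynomial (Fin 3) K) b) g ∧
      v = MvPolynomial.C v₁ * MvPolynomial.X 2
            - MvPolynomial.C a⁻¹
              * Polynomial.aeval (MvPolynomial.X 0 : MvPolynomial (Fin 3) K) b.derivative
              * Polynomial.aeval (MvPolynomial.C a * MvPolynomial.X 1
                  + Polynomial.aeval (MvPolynomial.X 0 : MvPolynomial (Fin 3) K) b) g
            - MvPolynomial.C (v₁ * l₂) * MvPolynomial.X 0 ∧
      h = MvPolynomial.C c₀ * u ^ 2 + MvPolynomial.C l₂ * u := by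
  have hdep : ∀ α β γ : K, C α * u + C β * v + C γ * h = 0 → α = 0 ∧ β = 0 ∧ γ = 0 := by
    intro α β γ he
    rw [Fintype.linearIndependent_iff] at hind
    have := hind ![α, β, γ] (by simpa [Fin.sum_univ_three, smul_eq_C_mul] using he)
    exact ⟨this 0, this 1, this 2⟩
  have hu0 : constantCoeff u = 0 := by simpa using hzero 0
  have hv0 : constantCoeff v = 0 := by simpa using hzero 1
  have hh0 : constantCoeff h = 0 := by simpa using hzero 2
  have hz : ∀ p ∈ supported K ({0, 1} : Set (Fin 3)), pderiv 2 p = 0 := by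
    intro p hp
    apply pderiv_eq_zero_of_notMem_vars
    intro h2
    have := mem_supported.1 hp h2
    simp at this
  have huz := hz u hu
  have hhz := hz h hh
  obtain ⟨htr, hminor, hdet⟩ := Matrix.invariants_eq_zero_of_isNilpotent hnil
  rw [Matrix.det_fin_three] at hdet
  simp only [polyJacobian, Matrix.of_apply, Matrix.cons_val, huz, hhz] at htr hminor hdet
  have hvy : pderiv 1 v = -pderiv 0 u := by linear_combination htr
  have hk : pderiv 1 u * pderiv 0 (-v) - pderiv 0 u ^ 2 = pderiv 2 v * pderiv 1 h := by
    rw [map_neg]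
    linear_combination hminor - pderiv 0 u * hvy
  have hJ : pderiv 2 v = 0 ∨ pderiv 0 u * pderiv 1 h = pderiv 1 u * pderiv 0 h := by
    rw [← sub_eq_zero (a := _ * _), ← mul_eq_zero]
    linear_combination -hdet
  have huy : pderiv 1 u ≠ 0 := by
    intro h1
    have h0 : pderiv 0 u = 0 := by
      rw [h1, zero_mul, zero_sub] at hk
      rcases hJ with h2 | h2
      · rw [h2, zero_mul, neg_eq_zero] at hk
        exact pow_eq_zero_iff two_ne_zero |>.1 hk
      · rw [h1, zero_mul] at h2
        rcases mul_eq_zero.1 h2 with h3 | h3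
        · exact h3
        · rw [h3, mul_zero, neg_eq_zero] at hk
          exact pow_eq_zero_iff two_ne_zero |>.1 hk
    have : u = 0 := eq_of_pderiv_eq (fun i => by fin_cases i <;> simp [h0, h1, huz])
      (by rw [hu0, map_zero])
    exact one_ne_zero (hdep 1 0 0 (by simp [this])).1
  -- Apply the preceding descent to `f = v_z`: if `v_zz ≠ 0`, then `h` is a multiple of `u`, against
  -- independence.
  obtain ⟨v₁, hv₁⟩ : ∃ v₁, pderiv 2 v = C v₁ := by
    rcases hJ with hJ | hJ
    · exact ⟨0, by rw [hJ, C_0]⟩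
    have hfy : pderiv 1 (pderiv 2 v) = 0 := by
      rw [pderiv_comm, hvy, map_neg, pderiv_comm, huz, map_zero, neg_zero]
    have hrel : pderiv 1 u * pderiv 0 (pderiv 2 v) + pderiv 2 (pderiv 2 v) * pderiv 1 h = 0 := by
      have huxz : pderiv 2 (pderiv 0 u) = 0 := by rw [pderiv_comm, huz, map_zero]
      have huyz : pderiv 2 (pderiv 1 u) = 0 := by rw [pderiv_comm, huz, map_zero]
      have hhyz : pderiv 2 (pderiv 1 h) = 0 := by rw [pderiv_comm, hhz, map_zero]
      have e := congrArg (pderiv 2) hk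
      simp only [map_sub, map_neg, pderiv_mul, pderiv_pow, huxz, huyz, hhyz, zero_mul, mul_zero,
        zero_add, add_zero, sub_zero] at e
      rw [pderiv_comm 2 0 v] at e
      linear_combination -e
    have hfz : pderiv 2 (pderiv 2 v) = 0 := by
      by_contra hne
      obtain ⟨c, hc⟩ := exists_pderiv_eq_C_mul huy huz hhz hJ _ _ le_rfl hfy hrel hne
      have : h = C c * u := eq_of_pderiv_eq (fun i => by rw [hc, pderiv_C_mul])
        (by rw [map_mul, hu0, hh0, mul_zero])
      exact one_ne_zero (hdep (-c) 0 1 (by rw [this]; simp)).2.2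
    rw [hfz, zero_mul, add_zero] at hrel
    exact eq_C_of_pderiv_eq_zero fun i => by
      fin_cases i <;> simp [hfz, hfy, (mul_eq_zero.1 hrel).resolve_left huy]
  rw [hv₁, ← pderiv_C_mul] at hk
  have hJ' : pderiv 0 u * pderiv 1 (C v₁ * h) = pderiv 1 u * pderiv 0 (C v₁ * h) := by
    rw [pderiv_C_mul, pderiv_C_mul]
    rcases hJ with hJ | hJ
    · rw [← hv₁, hJ]; ring
    · linear_combination C v₁ * hJ
  obtain ⟨l, μ, ρ, hux, hwx⟩ := exists_parabolic_level_curves (w := -v) (c := -v₁) huy huz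
    (by rw [map_neg, hv₁, C_neg]) (by rw [map_neg, hvy, neg_neg]) hk hJ'
  have hky : pderiv 1 (C v₁ * h) = (C l * u + C ρ) * pderiv 1 u := by
    rw [← hwx, ← hk, hux]; ring
  have hkx : pderiv 0 (C v₁ * h) = (C l * u + C ρ) * pderiv 0 u := by
    apply mul_left_cancel₀ huy
    rw [← hJ', hky]; ring
  have hl2 : C l = 2 * (C (l / 2) : MvPolynomial (Fin 3) K) := by
    rw [show (2 : MvPolynomial (Fin 3) K) = C 2 from rfl, ← C_mul]
    congr 1; field_simp
  -- Integrates `∇(v₁ h) = (l u + ρ) ∇u`.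
  have hkeq : C v₁ * h = C (l / 2) * u ^ 2 + C ρ * u := by
    apply eq_of_pderiv_eq
    · intro i
      have e : pderiv i (C v₁ * h) = (C l * u + C ρ) * pderiv i u := by
        fin_cases i
        · exact hkx
        · exact hky
        · simp [huz, hhz]
      rw [e, hl2, map_add, pderiv_C_mul, pderiv_C_mul, pderiv_pow]
      push_cast
      ring
    · simp [hu0, hh0]
  have hveq : v = C v₁ * X 2 - (C l * X 0 + C μ) * u - C ρ * X 0 := by
    rw [map_neg] at hwx
    apply eq_of_pderiv_eq
    · intro i
      fin_cases i
      · simp [pderiv_X]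
        linear_combination -hwx
      · simp [pderiv_X, hvy, hux]
      · simp [pderiv_X, hv₁, huz]
    · simp [hu0, hv0]
  -- If `v₁ = 0`, then `l u + ρ = 0`, so `l = ρ = 0` and `v = -μ u`.
  have hv₁0 : v₁ ≠ 0 := by
    rintro rfl
    rw [C_0, zero_mul, map_zero] at hky
    have h1 := (mul_eq_zero.1 hky.symm).resolve_right huy
    have h2 := congrArg (pderiv 1) h1
    rw [map_add, pderiv_C_mul, pderiv_C, add_zero, map_zero] at h2
    have h3 := (mul_eq_zero.1 h2).resolve_right huy
    rw [h3, zero_mul, zero_add] at h1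
    refine one_ne_zero (hdep μ 1 0 ?_).2.1
    rw [hveq, h1, h3]
    simp
  -- If `l = 0`, then `v₁ h = ρ u`.
  have hl0 : l ≠ 0 := by
    rintro rfl
    refine hv₁0 (hdep (-ρ) 0 v₁ ?_).2.2
    rw [hkeq]
    simp
  -- Normalized by `a = 1` and `b(0) = 0`; `c₀ = l / (2 v₁)` makes `b' = l x + μ`.
  set b : Polynomial K := Polynomial.C (v₁ * (l / (2 * v₁)) * 1) * Polynomial.X ^ 2
    + Polynomial.C μ * Polynomial.X + Polynomial.C 0 with hb
  have hvl : v₁ * (l / (2 * v₁)) * 1 = l / 2 := by field_simp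
  have hb' : Polynomial.aeval (X 0 : MvPolynomial (Fin 3) K) b.derivative = C l * X 0 + C μ := by
    rw [hb, hvl, hl2]
    simp [algebraMap_eq]
    ring
  -- After the shear `y ↦ y - b(x)`, `u` involves `y` alone; shearing back gives `g(y + b(x))`.
  obtain ⟨g, hg⟩ : ∃ g : Polynomial K, u = Polynomial.aeval
      (C 1 * X 1 + Polynomial.aeval (X 0 : MvPolynomial (Fin 3) K) b) g := by
    have hs : aeval ![X 0, X 1 - Polynomial.aeval (X 0 : MvPolynomial (Fin 3) K) b, X 2] u
        ∈ supported K ({1} : Set (Fin 3)) := by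
      apply mem_supported_of_pderiv_eq_zero
      intro i hi
      fin_cases i
      · exact pderiv_zero_aeval_shear b (by rw [hb', hux])
      · simp at hi
      · exact pderiv_two_aeval_shear b huz
    rw [supported_eq_adjoin_X, Set.image_singleton, Algebra.adjoin_singleton_eq_range_aeval] at hs
    obtain ⟨g, hg⟩ := hs
    refine ⟨g, ?_⟩
    conv_lhs => rw [← aeval_shear_aeval_shear b u]
    rw [← hg]
    simp [← Polynomial.aeval_algHom_apply]
  refine ⟨v₁, l / (2 * v₁), 1, μ, ρ / v₁, 0, g, b, hv₁0, 
    div_ne_zero hl0 (mul_ne_zero two_ne_zero hv₁0), one_ne_zero, ?_, ?_, hb, hg,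
    ?_, ?_⟩
  · have h1 := congrArg (aeval (0 : Fin 3 → K)) hg
    rw [← Polynomial.aeval_algHom_apply, map_add, ← Polynomial.aeval_algHom_apply,
      aeval_zero, hu0] at h1
    simpa [hb, Polynomial.aeval_def, Polynomial.eval₂_eq_eval_map] using h1.symm
  · by_contra hdeg
    rw [Polynomial.eq_C_of_natDegree_eq_zero (p := g) (by omega), Polynomial.aeval_C] at hg
    exact huy (by rw [hg, algebraMap_eq, pderiv_C])
  · rw [← hg, hb', inv_one, C_1, one_mul, mul_div_cancel₀ _ hv₁0]
    exact hveq
  · have hc : C v₁⁻¹ * C v₁ = (1 : MvPolynomial (Fin 3) K) := by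
      rw [← C_mul, inv_mul_cancel₀ hv₁0, C_1]
    have e1 : l / (2 * v₁) = v₁⁻¹ * (l / 2) := by field_simp
    have e2 : ρ / v₁ = v₁⁻¹ * ρ := by field_simp
    rw [e1, e2, C_mul, C_mul]
    linear_combination C v₁⁻¹ * hkeq - h * hc
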